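/- Let $\alpha,\beta>-1$, $c>0$ and $t_0\ge 1$ be real. For $n\in\mathbb Z_+=\{0,1,2,\dots\}$ let $$P_n^{(\alpha,\beta)}(x)=\binom{n+\alpha}{n}\,{}_2F_1\Big(-n,\,n+\alpha+\beta+1;\,\alpha+1;\,\tfrac{1-x}{2}\Big)$$ be the Jacobi polynomials and let $$\widehat P_0^{(\alpha,\beta)}(x)=\frac{1}{\sqrt{2^{\alpha+\beta+1}\,\mathrm B(\alpha+1,\beta+1)}},\qquad \widehat P_n^{(\alpha,\beta)}(x)=\sqrt{\frac{(2n+\alpha+\beta+1)\,n!\,\Gamma(n+\alpha+\beta+1)}{2^{\alpha+\beta+1}\,\Gamma(n+\alpha+1)\,\Gamma(n+\beta+1)}}\;P_n^{(\alpha,\beta)}(x)\quad(n\ge 1)$$ be the corresponding orthonormal polynomials for the weight $(1-x)^\alpha(1+x)^\beta$ on $[-1,1]$. For real $a,b,d$ put $$D_{a,b,d}:=(x^2-1)\frac{d^2}{dx^2}+\big[(a+b+2)x+a-b\big]\frac{d}{dx}+d,\qquad l^{(a,b)}_{n,d}:=d+n(n+a+b+1),$$ and define $$P_n(\alpha,\beta,c,t_0;x):=\sum_{k=0}^n\frac{1}{l^{(\alpha,\beta)}_{k,c}}\,\widehat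 P_k^{(\alpha,\beta)}(t_0)\,\widehat P_k^{(\alpha,\beta)}(x),\qquad n\in\mathbb Z_+.$$ Then the polynomials $P_n(x)=P_n(\alpha,\beta,c,t_0;x)$ are Sobolev orthogonal polynomials: $\deg P_n=n$ for all $n\in\mathbb Z_+$, and there are positive numbers $A_n$ such that for all $n,m\in\mathbb Z_+$ the following integral converges absolutely and $$\int_{-1}^1\big(P_n(x),P_n'(x),P_n''(x)\big)\,M_{\alpha,\beta,c}(x)\begin{pmatrix}P_m(x)\\P_m'(x)\\P_m''(x)\end{pmatrix}(t_0-x)(1-x)^\alpha(1+x)^\beta\,dx=A_n\,\delta_{n,m},$$ where $$M_{\alpha,\beta,c}(x)=\begin{pmatrix}c\\(\alpha+\beta+2)x+\alpha-\beta\\x^2-1\end{pmatrix}\big(c,\ (\alpha+\beta+2)x+\alpha-\beta,\ x^2-1\big).$$ Moreover, for $t_0=1$ the following differential equation of fourth order holds for every $n\in\mathbb Z_+$: $$D_{\alpha+1,\beta,0}\,D_{\alpha,\beta,c}\,P_n(\alpha,\beta,c,1;x)=l^{(\alpha+1,\beta)}_{n,0}\,D_{\alpha,\beta,c}\,P_n(\alpha,\beta,c,1;x),\qquad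 l^{(\alpha+1,\beta)}_{n,0}=n(n+\alpha+\beta+2).$$ -/

import Mathlib

noncomputable section

namespace JacobiSobolev

open Polynomial Finset MeasureTheory

/-- The Jacobi polynomial `P_n^{(α,β)}`: the terminating series
`binom (n+α) n * ₂F₁(-n, n+α+β+1; α+1; (1-x)/2)`, whose terms with index `k > n` vanish.
`(ascPochhammer ℝ k).eval a` is the shifted factorial `(a)_k = a (a+1) ⋯ (a+k-1)`. -/
def jacobi (α β : ℝ) (n : ℕ) : ℝ[X] :=
  C (Ring.choose ((n : ℝ) + α) n) *
    ∑ k ∈ range (n + 1),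
      C ((ascPochhammer ℝ k).eval (-(n : ℝ)) * (ascPochhammer ℝ k).eval ((n : ℝ) + α + β + 1) /
          ((ascPochhammer ℝ k).eval (α + 1) * (k.factorial : ℝ))) *
        (C (1 / 2) * (1 - X)) ^ k

/-- The orthonormal Jacobi polynomial for the weight `(1-x)^α (1+x)^β` on `[-1,1]`. -/
def jacobiHat (α β : ℝ) (n : ℕ) : ℝ[X] :=
  if n = 0 then
    C (1 / √((2 : ℝ) ^ (α + β + 1) * ProbabilityTheory.beta (α + 1) (β + 1)))
  else
    C √(((2 * n + α + β + 1) * (n.factorial : ℝ) * Real.Gamma (n + α + β + 1)) /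
        ((2 : ℝ) ^ (α + β + 1) * Real.Gamma (n + α + 1) * Real.Gamma (n + β + 1))) *
      jacobi α β n

/-- The differential operator
`D_{α,β,c} = (x²-1) d²/dx² + [(α+β+2) x + α - β] d/dx + c` acting on polynomials. -/
def diffOp (α β c : ℝ) (p : ℝ[X]) : ℝ[X] :=
  (X ^ 2 - 1) * derivative (derivative p) + (C (α + β + 2) * X + C (α - β)) * derivative p + C c * p

/-- `l_{n,c} = c + n (n + α + β + 1)`, with its dependence on `α, β` made explicit. -/
def eig (α β c : ℝ) (n : ℕ) : ℝ :=
  c + n * (n + α + β + 1)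

/-- The modified kernel polynomial `P_n(α,β,c,t₀;x)`. -/
def modKernel (α β c t₀ : ℝ) (n : ℕ) : ℝ[X] :=
  ∑ k ∈ range (n + 1), C (1 / eig α β c k * (jacobiHat α β k).eval t₀) * jacobiHat α β k

/-- The vector of coefficients of `D_{α,β,c}` at `x`, in increasing order of differentiation. -/
def coeffVec (α β c x : ℝ) : Fin 3 → ℝ :=
  ![c, (α + β + 2) * x + α - β, x ^ 2 - 1]

/-- The rank-one matrix `M_{α,β,c}(x)`: column `coeffVec` times row `coeffVec`. -/
def sobolevMatrix (α β c x : ℝ) : Matrix (Fin 3) (Fin 3) ℝ :=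
  Matrix.vecMulVec (coeffVec α β c x) (coeffVec α β c x)

/-- The vector `(p(x), p'(x), p''(x))`. -/
def jet (p : ℝ[X]) (x : ℝ) : Fin 3 → ℝ :=
  ![p.eval x, (derivative p).eval x, (derivative (derivative p)).eval x]

/-- The integrand of the Sobolev inner product of `p` and `q`. -/
def sobolevIntegrand (α β c t₀ : ℝ) (p q : ℝ[X]) (x : ℝ) : ℝ :=
  (jet p x ⬝ᵥ (Matrix.mulVec (sobolevMatrix α β c x) (jet q x))) *
    ((t₀ - x) * (1 - x) ^ α * (1 + x) ^ β)

end JacobiSobolev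

end

/-!
The operator `D_{α,β,c}` is diagonal on the orthonormal Jacobi polynomials `p_k`, with eigenvalues
`l_{k,c}`, so it maps `P_n(α,β,c,t₀;·)` to the kernel polynomial `K_n = ∑_{k ≤ n} p_k(t₀) p_k`.
Since `M_{α,β,c}` has rank one, the Sobolev form of `P_n` and `P_m` is the integral of
`K_n(x) K_m(x) (t₀ - x)` against the Jacobi weight. For `m < n` the reproducing property of `K_n`
evaluates it at `t₀`, where the factor `t₀ - x` vanishes; for `m = n` the integrand is nonnegative
because `t₀ ≥ 1`. When `t₀ = 1`, that factor turns the weight `(α, β)` into `(α + 1, β)`, so the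
`K_n` are orthogonal for a weight with respect to which `D_{α+1,β,0}` is symmetric; as this operator
does not raise degrees, the `K_n` are its eigenfunctions.

The Jacobi polynomials themselves are handled through the Gauss hypergeometric equation, and
their norms through the recursion that the Dirichlet form of `D_{α,β,0}` gives because the
derivative of `P_{n+1}^{(α,β)}` is a multiple of `P_n^{(α+1,β+1)}`.
-/

noncomputable section

namespace JacobiSobolev

open Polynomial Finset MeasureTheory

/-! ### Kernel polynomials of an orthonormal sequence -/

section Kernel

variable {K : Type*} [Field K]

lemma map_C_mul (L : K[X] →ₗ[K] K) (r : K) (p : K[X]) : L (C r * p) = r * L p := by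
  rw [← smul_eq_C_mul, map_smul, smul_eq_mul]

/-- Orthonormality of a sequence of polynomials with respect to the symmetric bilinear form
`(f, g) ↦ L (f * g)` of a linear functional `L`. -/
def IsOrthonormal (L : K[X] →ₗ[K] K) (p : ℕ → K[X]) : Prop :=
  ∀ n m, L (p n * p m) = if n = m then 1 else 0

/-- The `n`-th kernel (Christoffel–Darboux) polynomial `∑_{k ≤ n} p_k(t) p_k(x)` of a sequence of
polynomials, with base point `t`. -/
def kernel (p : ℕ → K[X]) (t : K) (n : ℕ) : K[X] :=
  ∑ k ∈ range (n + 1), C ((p k).eval t) * p k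

lemma degree_sum_C_mul (S : Sequence K) {a : ℕ → K} {n : ℕ} (ha : a n ≠ 0) :
    (∑ k ∈ range (n + 1), C (a k) * S k).degree = n := by
  have htop : (C (a n) * S n).degree = n := by rw [degree_C_mul ha, S.degree_eq]
  have hlow : (∑ k ∈ range n, C (a k) * S k).degree < n := by
    rw [← mem_degreeLT]
    refine Submodule.sum_mem _ fun k hk => ?_
    rw [← smul_eq_C_mul]
    refine Submodule.smul_mem _ _ (mem_degreeLT.2 ?_)
    rw [S.degree_eq]
    exact_mod_cast mem_range.1 hk
  rw [sum_range_succ, degree_add_eq_right_of_degree_lt (htop.symm ▸ hlow), htop]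

lemma degree_kernel (S : Sequence K) {t : K} {n : ℕ} (ht : (S n).eval t ≠ 0) :
    (kernel S t n).degree = n :=
  degree_sum_C_mul S ht

variable {L : K[X] →ₗ[K] K}

lemma IsOrthonormal.apply_kernel_mul_self_of_le {p : ℕ → K[X]} (hp : IsOrthonormal L p) (t : K)
    {k n : ℕ} (hk : k ≤ n) : L (kernel p t n * p k) = (p k).eval t := by
  have hterm (j : ℕ) : L (C ((p j).eval t) * p j * p k) = if j = k then (p k).eval t else 0 := by
    rw [mul_assoc, map_C_mul, hp, mul_ite, mul_one, mul_zero]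
    exact if_ctx_congr Iff.rfl (fun h => by rw [h]) fun _ => rfl
  rw [kernel, sum_mul, map_sum, sum_congr rfl fun j _ => hterm j, sum_ite_eq',
    if_pos (mem_range.2 (Nat.lt_succ_of_le hk))]

lemma IsOrthonormal.apply_kernel_mul {S : Sequence K} (hS : IsOrthonormal L S) (t : K) {n : ℕ}
    {q : K[X]} (hq : q.degree ≤ n) : L (kernel S t n * q) = q.eval t := by
  have hspan : q ∈ Submodule.span K (S '' Set.Iic n) := by
    rw [S.span_degreeLE fun k _ => (leadingCoeff_ne_zero.2 (S.ne_zero k)).isUnit]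
    exact mem_degreeLE.2 hq
  have hEqOn : Set.EqOn (L ∘ₗ LinearMap.mulLeft K (kernel S t n)) (leval t) (S '' Set.Iic n) := by
    rintro _ ⟨k, hk, rfl⟩
    exact hS.apply_kernel_mul_self_of_le t hk
  exact LinearMap.eqOn_span hEqOn hspan

lemma IsOrthonormal.apply_kernel_mul_sub_mul {S : Sequence K} (hS : IsOrthonormal L S) (t : K)
    {n : ℕ} {q : K[X]} (hq : q.degree < n) : L (kernel S t n * ((C t - X) * q)) = 0 := by
  have hdeg : ((C t - X) * q).degree ≤ (n : WithBot ℕ) := by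
    rw [← neg_sub, neg_mul, degree_neg, degree_mul, degree_X_sub_C, add_comm]
    exact Nat.WithBot.add_one_le_of_lt hq
  rw [hS.apply_kernel_mul t hdeg]
  simp

lemma IsOrthonormal.apply_kernel_mul_kernel_of_ne {S : Sequence K} (hS : IsOrthonormal L S) {t : K}
    (ht : ∀ n, (S n).eval t ≠ 0) {n m : ℕ} (h : n ≠ m) :
    L (kernel S t n * ((C t - X) * kernel S t m)) = 0 := by
  wlog hlt : m < n generalizing n m
  · rw [← this h.symm (h.lt_of_le (not_lt.1 hlt))]
    congr 1
    ring
  refine hS.apply_kernel_mul_sub_mul t ?_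
  rw [degree_kernel S (ht m)]
  exact_mod_cast hlt

/-- If `p` is orthogonal to all lower degrees and the symmetric operator `D` preserves the lower
degrees, then `D p - r p` is orthogonal to all lower degrees too, hence to itself. -/
lemma eq_C_mul_of_symmetric_of_orthogonal (hL : ∀ p ≠ 0, L (p * p) ≠ 0) {D : K[X] → K[X]}
    (hD : ∀ p q, L (D p * q) = L (p * D q)) {n : ℕ}
    (hDdeg : ∀ q : K[X], q.degree < n → (D q).degree < n) {p : K[X]}
    (hp : ∀ q : K[X], q.degree < n → L (p * q) = 0) {r : K} (hr : (D p - C r * p).degree < n) :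
    D p = C r * p := by
  have horth (q : K[X]) (hq : q.degree < n) : L ((D p - C r * p) * q) = 0 := by
    rw [sub_mul, map_sub, hD, hp _ (hDdeg q hq), mul_assoc, map_C_mul, hp q hq, mul_zero, sub_zero]
  by_contra hne
  exact hL _ (sub_ne_zero.2 hne) (horth _ hr)

end Kernel

/-! ### Terminating hypergeometric series -/

section Hypergeometric

variable {K : Type*} [Field K]

lemma ordinaryHypergeometricCoefficient_zero (a b c : K) :
    ordinaryHypergeometricCoefficient a b c 0 = 1 := by
  simp [ordinaryHypergeometricCoefficient]

lemma ordinaryHypergeometricCoefficient_neg_natCast_of_lt (b c : K) {n k : ℕ} (h : n < k) :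
    ordinaryHypergeometricCoefficient (-(n : K)) b c k = 0 := by
  rw [ordinaryHypergeometricCoefficient,
    (ascPochhammer_eval_eq_zero_iff k _).2 ⟨n, h, (neg_neg _).symm⟩]
  ring

lemma ordinaryHypergeometricCoefficient_succ [CharZero K] (a b : K) {c : K} {k : ℕ}
    (hc : c + k ≠ 0) :
    (k + 1) * (c + k) * ordinaryHypergeometricCoefficient a b c (k + 1) =
      (a + k) * (b + k) * ordinaryHypergeometricCoefficient a b c k := by
  have hk : (k : K) + 1 ≠ 0 := Nat.cast_add_one_ne_zero k
  simp only [ordinaryHypergeometricCoefficient, ascPochhammer_succ_eval, Nat.factorial_succ,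
    Nat.cast_mul, Nat.cast_add, Nat.cast_one, mul_inv]
  field_simp

lemma ordinaryHypergeometricCoefficient_succ_eq_shift [CharZero K] (a b : K) {c : K} (hc : c ≠ 0)
    (k : ℕ) :
    (k + 1) * ordinaryHypergeometricCoefficient a b c (k + 1) =
      a * b / c * ordinaryHypergeometricCoefficient (a + 1) (b + 1) (c + 1) k := by
  have hk : (k : K) + 1 ≠ 0 := Nat.cast_add_one_ne_zero k
  simp only [ordinaryHypergeometricCoefficient, ascPochhammer_succ_left, eval_mul, eval_X,
    eval_comp, eval_add, eval_one, Nat.factorial_succ, Nat.cast_mul, Nat.cast_add, Nat.cast_one,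
    mul_inv]
  field_simp

/-- The polynomial `₂F₁(-n, b; c; x)`. -/
def hypergeometricPoly (n : ℕ) (b c : K) : K[X] :=
  ∑ k ∈ range (n + 1), C (ordinaryHypergeometricCoefficient (-(n : K)) b c k) * X ^ k

lemma coeff_hypergeometricPoly (n : ℕ) (b c : K) (k : ℕ) :
    (hypergeometricPoly n b c).coeff k = ordinaryHypergeometricCoefficient (-(n : K)) b c k := by
  simp only [hypergeometricPoly, finsetSum_coeff, coeff_C_mul_X_pow, sum_ite_eq, mem_range,
    Nat.lt_succ_iff]
  split_ifs with h
  · rfl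
  · exact (ordinaryHypergeometricCoefficient_neg_natCast_of_lt b c (not_le.1 h)).symm

lemma derivative_hypergeometricPoly_succ [CharZero K] (n : ℕ) (b : K) {c : K} (hc : c ≠ 0) :
    derivative (hypergeometricPoly (n + 1) b c) =
      C (-((n + 1) * b) / c) * hypergeometricPoly n (b + 1) (c + 1) := by
  ext k
  rw [coeff_derivative, coeff_C_mul, coeff_hypergeometricPoly, coeff_hypergeometricPoly, mul_comm,
    ordinaryHypergeometricCoefficient_succ_eq_shift _ _ hc]
  push_cast
  rw [neg_add_rev, neg_add_cancel_comm]
  ring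

lemma coeff_X_mul_derivative {R : Type*} [CommSemiring R] (p : R[X]) (k : ℕ) :
    (X * derivative p).coeff k = k * p.coeff k := by
  cases k with
  | zero => simp
  | succ k => rw [coeff_X_mul, coeff_derivative, mul_comm, Nat.cast_succ]

lemma coeff_X_sq_mul_derivative_derivative {R : Type*} [CommRing R] (p : R[X]) (k : ℕ) :
    (X ^ 2 * derivative (derivative p)).coeff k = k * (k - 1) * p.coeff k := by
  have h : X ^ 2 * derivative (derivative p) =
      X * derivative (X * derivative p) - X * derivative p := by
    rw [derivative_mul, derivative_X]
    ring
  rw [h, coeff_sub, coeff_X_mul_derivative, coeff_X_mul_derivative]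
  ring

lemma hypergeometricPoly_differential_equation [CharZero K] (n : ℕ) (b : K) {c : K}
    (hc : ∀ k : ℕ, c + k ≠ 0) :
    X * (1 - X) * derivative (derivative (hypergeometricPoly n b c)) +
        (C c - C (b - n + 1) * X) * derivative (hypergeometricPoly n b c) +
      C (n * b) * hypergeometricPoly n b c = 0 := by
  set F := hypergeometricPoly n b c with hF
  have h : X * (1 - X) * derivative (derivative F) + (C c - C (b - n + 1) * X) * derivative F +
        C (n * b) * F =
      X * derivative (derivative F) - X ^ 2 * derivative (derivative F) + C c * derivative F -
        C (b - n + 1) * (X * derivative F) + C (n * b) * F := by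
    ring
  ext k
  have hrec := ordinaryHypergeometricCoefficient_succ (-(n : K)) b (hc k)
  rw [h]
  simp only [coeff_add, coeff_sub, coeff_C_mul, coeff_X_mul_derivative,
    coeff_X_sq_mul_derivative_derivative, coeff_derivative, hF, coeff_hypergeometricPoly,
    coeff_zero]
  linear_combination hrec

end Hypergeometric

/-! ### Jacobi polynomials and their differential operator -/

section Jacobi

variable {α β : ℝ}

lemma choose_natCast_add (α : ℝ) (n : ℕ) :
    Ring.choose ((n : ℝ) + α) n = (ascPochhammer ℝ n).eval (α + 1) / n.factorial := by
  have h := Ring.factorial_nsmul_multichoose_eq_ascPochhammer (α + 1) n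
  rw [ascPochhammer_smeval_eq_eval, nsmul_eq_mul] at h
  rw [eq_div_iff (by positivity), ← h, mul_comm, Ring.choose]
  congr 2
  ring

lemma jacobi_eq_C_mul_comp (α β : ℝ) (n : ℕ) :
    jacobi α β n = C ((ascPochhammer ℝ n).eval (α + 1) / n.factorial) *
      (hypergeometricPoly n (n + α + β + 1) (α + 1)).comp (C (1 / 2) * (1 - X)) := by
  rw [jacobi, choose_natCast_add, hypergeometricPoly, Polynomial.sum_comp]
  congr 1
  refine sum_congr rfl fun k _ => ?_
  rw [C_mul_comp, X_pow_comp, ordinaryHypergeometricCoefficient]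
  congr 2
  field_simp

@[simp]
lemma jacobi_zero (α β : ℝ) : jacobi α β 0 = 1 := by
  simp [jacobi]

lemma eval_one_jacobi (α β : ℝ) (n : ℕ) :
    (jacobi α β n).eval 1 = (ascPochhammer ℝ n).eval (α + 1) / n.factorial := by
  rw [jacobi_eq_C_mul_comp, eval_mul, eval_C, eval_comp]
  simp [← coeff_zero_eq_eval_zero, coeff_hypergeometricPoly,
    ordinaryHypergeometricCoefficient_zero]

lemma derivative_jacobi_succ (hα : -1 < α) (β : ℝ) (n : ℕ) :
    derivative (jacobi α β (n + 1)) =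
      C ((n + α + β + 2) / 2) * jacobi (α + 1) (β + 1) n := by
  have hα₀ : α + 1 ≠ 0 := by linarith
  have hn : (n : ℝ) + 1 ≠ 0 := n.cast_add_one_ne_zero
  have hb : (n + 1 : ℕ) + α + β + 1 + 1 = n + (α + 1) + (β + 1) + 1 := by push_cast; ring
  have hconst : (ascPochhammer ℝ (n + 1)).eval (α + 1) / (n + 1).factorial *
      (1 / 2 * (-1)) * (-((n + 1) * ((n + 1 : ℕ) + α + β + 1)) / (α + 1)) =
      (n + α + β + 2) / 2 * ((ascPochhammer ℝ n).eval (α + 1 + 1) / n.factorial) := by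
    rw [ascPochhammer_succ_left, Nat.factorial_succ]
    simp only [eval_mul, eval_X, eval_comp, eval_add, eval_one]
    push_cast
    field_simp
    ring
  have hderiv : derivative (C (1 / 2 : ℝ) * (1 - X)) = C (1 / 2 * (-1)) := by
    rw [derivative_C_mul, derivative_sub, derivative_one, derivative_X, C_mul, C_neg, C_1, zero_sub]
  rw [jacobi_eq_C_mul_comp, jacobi_eq_C_mul_comp, derivative_C_mul, derivative_comp, hderiv,
    derivative_hypergeometricPoly_succ _ _ hα₀, hb, C_mul_comp, ← mul_assoc, ← mul_assoc,
    ← mul_assoc, ← C_mul, ← C_mul, ← C_mul, hconst]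

lemma degree_jacobi (hα : -1 < α) (hβ : -1 < β) (n : ℕ) : (jacobi α β n).degree = n := by
  induction n generalizing α β with
  | zero => simp
  | succ n ih =>
    have hderiv : (derivative (jacobi α β (n + 1))).degree = n := by
      rw [derivative_jacobi_succ hα, degree_C_mul (by linarith [n.cast_nonneg (α := ℝ)]),
        ih (by linarith) (by linarith)]
    have hne : (jacobi α β (n + 1)).natDegree ≠ 0 := by
      intro h
      rw [derivative_of_natDegree_zero h] at hderiv
      simp at hderiv
    rw [degree_derivative hne, Nat.cast_inj] at hderiv
    rw [degree_eq_iff_natDegree_eq_of_pos n.succ_pos]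
    omega

lemma eval_jacobi_pos (hα : -1 < α) (hβ : -1 < β) (n : ℕ) {t : ℝ} (ht : 1 ≤ t) :
    0 < (jacobi α β n).eval t := by
  induction n generalizing α β t with
  | zero => simp
  | succ n ih =>
    have hmono : MonotoneOn (fun x => (jacobi α β (n + 1)).eval x) (Set.Ici 1) := by
      refine monotoneOn_of_deriv_nonneg (convex_Ici 1) (Polynomial.continuousOn _)
        (Polynomial.differentiable _).differentiableOn fun x hx => ?_
      rw [interior_Ici] at hx
      rw [Polynomial.deriv, derivative_jacobi_succ hα, eval_mul, eval_C]
      exact mul_nonneg (by linarith [n.cast_nonneg (α := ℝ)])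
        (ih (by linarith) (by linarith) (le_of_lt hx)).le
    have hone : 0 < (jacobi α β (n + 1)).eval 1 := by
      rw [eval_one_jacobi]
      exact div_pos (ascPochhammer_pos _ _ (by linarith)) (by positivity)
    exact hone.trans_le (hmono Set.self_mem_Ici ht ht)

lemma eig_pos {c : ℝ} (hα : -1 < α) (hβ : -1 < β) (hc : 0 < c) (n : ℕ) : 0 < eig α β c n := by
  rw [eig]
  rcases n with _ | n
  · simpa using hc
  · have h : 0 < ((n + 1 : ℕ) : ℝ) + α + β + 1 := by
      push_cast
      linarith [n.cast_nonneg (α := ℝ)]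
    positivity

lemma eig_injective (hα : -1 < α) (hβ : -1 < β) (c : ℝ) : Function.Injective (eig α β c) := by
  intro n m h
  by_contra hne
  have hfactor : ((n : ℝ) - m) * (n + m + α + β + 1) = 0 := by
    simp only [eig] at h
    linear_combination h
  have hsum : (1 : ℝ) ≤ n + m := by exact_mod_cast (by omega : 1 ≤ n + m)
  exact mul_ne_zero (sub_ne_zero.2 (Nat.cast_injective.ne hne)) (by linarith) hfactor

lemma diffOp_C_mul (α β c r : ℝ) (p : ℝ[X]) :
    diffOp α β c (C r * p) = C r * diffOp α β c p := by
  simp only [diffOp, derivative_C_mul]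
  ring

lemma diffOp_sum {ι : Type*} (α β c : ℝ) (s : Finset ι) (f : ι → ℝ[X]) :
    diffOp α β c (∑ i ∈ s, f i) = ∑ i ∈ s, diffOp α β c (f i) := by
  simp only [diffOp, derivative_sum, mul_sum, sum_add_distrib]

lemma coeff_diffOp (α β c : ℝ) (p : ℝ[X]) (k : ℕ) :
    (diffOp α β c p).coeff k = eig α β c k * p.coeff k + (α - β) * (k + 1) * p.coeff (k + 1) -
      (k + 2) * (k + 1) * p.coeff (k + 2) := by
  have h : diffOp α β c p = X ^ 2 * derivative (derivative p) - derivative (derivative p) +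
      (C (α + β + 2) * (X * derivative p) + C (α - β) * derivative p) + C c * p := by
    rw [diffOp]
    ring
  rw [h]
  simp only [coeff_add, coeff_sub, coeff_C_mul, coeff_X_mul_derivative,
    coeff_X_sq_mul_derivative_derivative, coeff_derivative, eig]
  push_cast
  ring

lemma degree_diffOp_lt (α β c : ℝ) {p : ℝ[X]} {n : ℕ} (hp : p.degree < n) :
    (diffOp α β c p).degree < n := by
  rw [degree_lt_iff_coeff_zero] at hp ⊢
  intro k hk
  rw [coeff_diffOp, hp k hk, hp (k + 1) (by omega), hp (k + 2) (by omega)]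
  ring

lemma degree_diffOp_sub_eig_mul_lt (α β c : ℝ) {p : ℝ[X]} {n : ℕ} (hp : p.degree ≤ n) :
    (diffOp α β c p - C (eig α β c n) * p).degree < n := by
  rw [degree_le_iff_coeff_zero] at hp
  rw [degree_lt_iff_coeff_zero]
  intro k hk
  rw [coeff_sub, coeff_diffOp, coeff_C_mul, hp (k + 1) (by exact_mod_cast (by omega)),
    hp (k + 2) (by exact_mod_cast (by omega))]
  rcases hk.eq_or_lt with rfl | hk
  · ring
  · rw [hp k (by exact_mod_cast hk)]
    ring

lemma diffOp_comp_half_one_sub (α β c : ℝ) (p : ℝ[X]) :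
    diffOp α β c (p.comp (C (1 / 2) * (1 - X))) =
      (C c * p - (X * (1 - X) * derivative (derivative p) +
        (C (α + 1) - C (α + β + 2) * X) * derivative p)).comp (C (1 / 2) * (1 - X)) := by
  refine Polynomial.funext fun x => ?_
  simp only [diffOp, one_div, derivative_comp, derivative_mul, derivative_C, zero_mul,
    derivative_one, derivative_X, zero_sub, mul_neg, mul_one, zero_add, neg_mul,
    derivative_neg, neg_neg, map_add, map_sub, eval_add, eval_mul, eval_sub, eval_pow, eval_X,
    eval_one, eval_C, eval_comp, eval_neg, map_one, sub_comp, mul_comp, C_comp, add_comp, X_comp,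
    one_comp]
  ring

lemma diffOp_jacobi (hα : -1 < α) (β c : ℝ) (n : ℕ) :
    diffOp α β c (jacobi α β n) = C (eig α β c n) * jacobi α β n := by
  set F := hypergeometricPoly n (n + α + β + 1) (α + 1) with hF
  have hGauss := hypergeometricPoly_differential_equation n (n + α + β + 1) (c := α + 1)
    fun k => by linarith [k.cast_nonneg (α := ℝ)]
  have hdiffOp : C c * F - (X * (1 - X) * derivative (derivative F) +
      (C (α + 1) - C (α + β + 2) * X) * derivative F) = C (eig α β c n) * F := by
    rw [← hF, show (n : ℝ) + α + β + 1 - n + 1 = α + β + 2 by ring] at hGauss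
    rw [eig, C_add (a := c)]
    linear_combination -hGauss
  rw [jacobi_eq_C_mul_comp, diffOp_C_mul, diffOp_comp_half_one_sub, hdiffOp, C_mul_comp,
    mul_left_comm]

end Jacobi

/-! ### The Jacobi weight and its moment functional -/

section Moment

variable {α β : ℝ}

/-- The weight `(1-x)^α (1+x)^β`, meaningful on `(-1,1)`. -/
def jacobiWeight (α β x : ℝ) : ℝ :=
  (1 - x) ^ α * (1 + x) ^ β

lemma jacobiWeight_pos (α β : ℝ) {x : ℝ} (hx : x ∈ Set.Ioo (-1 : ℝ) 1) : 0 < jacobiWeight α β x :=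
  mul_pos (Real.rpow_pos_of_pos (by linarith [hx.2]) _)
    (Real.rpow_pos_of_pos (by linarith [hx.1]) _)

lemma jacobiWeight_add_one_left (α β : ℝ) {x : ℝ} (hx : 1 - x ≠ 0) :
    jacobiWeight (α + 1) β x = (1 - x) * jacobiWeight α β x := by
  rw [jacobiWeight, jacobiWeight, Real.rpow_add_one hx]
  ring

lemma jacobiWeight_add_one_right (α β : ℝ) {x : ℝ} (hx : 1 + x ≠ 0) :
    jacobiWeight α (β + 1) x = (1 + x) * jacobiWeight α β x := by
  rw [jacobiWeight, jacobiWeight, Real.rpow_add_one hx]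
  ring

lemma intervalIntegrable_jacobiWeight (hα : -1 < α) (hβ : -1 < β) :
    IntervalIntegrable (jacobiWeight α β) volume (-1) 1 := by
  have hleft : IntervalIntegrable (jacobiWeight α β) volume (-1) 0 := by
    have h : IntervalIntegrable (fun x : ℝ => (1 + x) ^ β) volume (-1) 0 := by
      simpa using
        (intervalIntegral.intervalIntegrable_rpow' (a := 0) (b := 1) hβ).comp_add_left 1
    refine h.continuousOn_mul (ContinuousOn.rpow_const (by fun_prop) fun x hx => Or.inl ?_)
    rw [Set.uIcc_of_le (by norm_num)] at hx
    linarith [hx.2]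
  have hright : IntervalIntegrable (jacobiWeight α β) volume 0 1 := by
    have h : IntervalIntegrable (fun x : ℝ => (1 - x) ^ α) volume 0 1 := by
      simpa using
        ((intervalIntegral.intervalIntegrable_rpow' (a := 0) (b := 1) hα).comp_sub_left 1).symm
    refine h.mul_continuousOn (ContinuousOn.rpow_const (by fun_prop) fun x hx => Or.inl ?_)
    rw [Set.uIcc_of_le (by norm_num)] at hx
    linarith [hx.1]
  exact hleft.trans hright

lemma intervalIntegrable_eval_mul_jacobiWeight (hα : -1 < α) (hβ : -1 < β) (p : ℝ[X]) :
    IntervalIntegrable (fun x => p.eval x * jacobiWeight α β x) volume (-1) 1 :=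
  (intervalIntegrable_jacobiWeight hα hβ).continuousOn_mul p.continuousOn

/-- The moment functional `p ↦ ∫_{-1}^1 p(x) (1-x)^α (1+x)^β dx`. The bounds on `α` and `β` make
the weight integrable, without which linearity fails. -/
def jacobiMoment (hα : -1 < α) (hβ : -1 < β) : ℝ[X] →ₗ[ℝ] ℝ where
  toFun p := ∫ x in (-1 : ℝ)..1, p.eval x * jacobiWeight α β x
  map_add' p q := by
    simp only [eval_add, add_mul]
    exact intervalIntegral.integral_add (intervalIntegrable_eval_mul_jacobiWeight hα hβ p)
      (intervalIntegrable_eval_mul_jacobiWeight hα hβ q)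
  map_smul' r p := by
    simp only [eval_smul, smul_eq_mul, mul_assoc, intervalIntegral.integral_const_mul,
      RingHom.id_apply]

lemma jacobiMoment_apply (hα : -1 < α) (hβ : -1 < β) (p : ℝ[X]) :
    jacobiMoment hα hβ p = ∫ x in (-1 : ℝ)..1, p.eval x * jacobiWeight α β x :=
  rfl

lemma jacobiMoment_pos (hα : -1 < α) (hβ : -1 < β) {p : ℝ[X]} (hp : p ≠ 0)
    (hnonneg : ∀ x ∈ Set.Ioo (-1 : ℝ) 1, 0 ≤ p.eval x) : 0 < jacobiMoment hα hβ p := by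
  have hsupport : Set.Ioo (-1 : ℝ) 1 \ (p.roots.toFinset : Set ℝ) ⊆
      Function.support (fun x => p.eval x * jacobiWeight α β x) ∩ Set.Ioc (-1) 1 := by
    rintro x ⟨hx, hroot⟩
    refine ⟨mul_ne_zero (fun h => hroot ?_) (jacobiWeight_pos α β hx).ne',
      Set.Ioo_subset_Ioc_self hx⟩
    simpa [hp] using h
  have hae : ∀ᵐ x ∂(volume.restrict (Set.uIoc (-1 : ℝ) 1)), x ∈ Set.Ioo (-1 : ℝ) 1 := by
    rw [Set.uIoc_of_le (by norm_num), ← restrict_Ioo_eq_restrict_Ioc]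
    exact ae_restrict_mem measurableSet_Ioo
  rw [jacobiMoment_apply, intervalIntegral.integral_pos_iff_support_of_nonneg_ae' _
    (intervalIntegrable_eval_mul_jacobiWeight hα hβ p)]
  · refine ⟨by norm_num, lt_of_lt_of_le ?_ (measure_mono hsupport)⟩
    rw [measure_sdiff_null (Finset.measure_zero _ _)]
    simp
  · filter_upwards [hae] with x hx
    exact mul_nonneg (hnonneg x hx) (jacobiWeight_pos α β hx).le

lemma jacobiMoment_mul_self_pos (hα : -1 < α) (hβ : -1 < β) {p : ℝ[X]} (hp : p ≠ 0) :
    0 < jacobiMoment hα hβ (p * p) := by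
  refine jacobiMoment_pos hα hβ (mul_ne_zero hp hp) fun x _ => ?_
  rw [eval_mul]
  exact mul_self_nonneg _

lemma jacobiMoment_add_one_left (hα : -1 < α) (hα' : -1 < α + 1) (hβ : -1 < β) (p : ℝ[X]) :
    jacobiMoment hα' hβ p = jacobiMoment hα hβ ((1 - X) * p) := by
  refine intervalIntegral.integral_congr_Ioo_of_le (by norm_num) fun x hx => ?_
  simp only [jacobiWeight_add_one_left α β (sub_pos.2 hx.2).ne', eval_mul, eval_sub, eval_one,
    eval_X]
  ring

lemma jacobiMoment_add_one_right (hα : -1 < α) (hβ : -1 < β) (hβ' : -1 < β + 1) (p : ℝ[X]) :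
    jacobiMoment hα hβ' p = jacobiMoment hα hβ ((1 + X) * p) := by
  refine intervalIntegral.integral_congr_Ioo_of_le (by norm_num) fun x hx => ?_
  simp only [jacobiWeight_add_one_right α β (neg_lt_iff_pos_add'.1 hx.1).ne', eval_mul, eval_add,
    eval_one, eval_X]
  ring

lemma hasDerivAt_jacobiWeight_mul_eval (α β : ℝ) (p : ℝ[X]) {x : ℝ} (hx : x ∈ Set.Ioo (-1 : ℝ) 1) :
    HasDerivAt (fun y => jacobiWeight (α + 1) (β + 1) y * p.eval y)
      (((1 - X ^ 2) * derivative p - (C (α + β + 2) * X + C (α - β)) * p).eval x *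
        jacobiWeight α β x) x := by
  have hsub : 1 - x ≠ 0 := (sub_pos.2 hx.2).ne'
  have hadd : 1 + x ≠ 0 := (neg_lt_iff_pos_add'.1 hx.1).ne'
  have hderiv_sub : HasDerivAt (fun y : ℝ => (1 - y) ^ (α + 1)) _ x :=
    ((hasDerivAt_id x).const_sub 1).rpow_const (Or.inl hsub)
  have hderiv_add : HasDerivAt (fun y : ℝ => (1 + y) ^ (β + 1)) _ x :=
    ((hasDerivAt_id x).const_add 1).rpow_const (Or.inl hadd)
  refine ((hderiv_sub.mul hderiv_add).mul (p.hasDerivAt x)).congr_deriv ?_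
  simp only [id, jacobiWeight, Pi.mul_apply, add_sub_cancel_right, Real.rpow_add_one hsub,
    Real.rpow_add_one hadd, eval_add, eval_sub, eval_mul, eval_pow, eval_C, eval_X, eval_one]
  ring

lemma jacobiMoment_one_sub_sq_mul_derivative (hα : -1 < α) (hβ : -1 < β) (p : ℝ[X]) :
    jacobiMoment hα hβ ((1 - X ^ 2) * derivative p) =
      jacobiMoment hα hβ ((C (α + β + 2) * X + C (α - β)) * p) := by
  have hcont : ContinuousOn (fun x => jacobiWeight (α + 1) (β + 1) x * p.eval x)
      (Set.Icc (-1) 1) :=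
    ((ContinuousOn.rpow_const (by fun_prop) fun _ _ => Or.inr (by linarith)).mul
      (ContinuousOn.rpow_const (by fun_prop) fun _ _ => Or.inr (by linarith))).mul p.continuousOn
  rw [← sub_eq_zero, ← map_sub, jacobiMoment_apply,
    intervalIntegral.integral_eq_sub_of_hasDerivAt_of_le (by norm_num) hcont
      (fun x hx => hasDerivAt_jacobiWeight_mul_eval α β p hx)
      (intervalIntegrable_eval_mul_jacobiWeight hα hβ _)]
  simp [jacobiWeight, Real.zero_rpow (by linarith : α + 1 ≠ 0),
    Real.zero_rpow (by linarith : β + 1 ≠ 0)]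

lemma jacobiMoment_diffOp_mul (hα : -1 < α) (hβ : -1 < β) (c : ℝ) (p q : ℝ[X]) :
    jacobiMoment hα hβ (diffOp α β c p * q) =
      jacobiMoment hα hβ ((1 - X ^ 2) * (derivative p * derivative q)) +
        c * jacobiMoment hα hβ (p * q) := by
  have hsplit : diffOp α β c p * q = (1 - X ^ 2) * (derivative p * derivative q) + C c * (p * q) -
      ((1 - X ^ 2) * derivative (derivative p * q) -
        (C (α + β + 2) * X + C (α - β)) * (derivative p * q)) := by
    rw [diffOp, derivative_mul]
    ring
  rw [hsplit, map_sub, map_sub, jacobiMoment_one_sub_sq_mul_derivative, sub_self, sub_zero, map_add,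
    map_C_mul]

lemma jacobiMoment_diffOp_comm (hα : -1 < α) (hβ : -1 < β) (c : ℝ) (p q : ℝ[X]) :
    jacobiMoment hα hβ (diffOp α β c p * q) = jacobiMoment hα hβ (p * diffOp α β c q) := by
  rw [mul_comm p, jacobiMoment_diffOp_mul, jacobiMoment_diffOp_mul, mul_comm q,
    mul_comm (derivative q)]

lemma beta_eq_integral {a b : ℝ} (ha : 0 < a) (hb : 0 < b) :
    ProbabilityTheory.beta a b = ∫ x in (0 : ℝ)..1, x ^ (a - 1) * (1 - x) ^ (b - 1) := by
  rw [ProbabilityTheory.beta_eq_betaIntegralReal a b ha hb, ← Complex.ofReal_re (∫ x in _.._, _),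
    ← intervalIntegral.integral_ofReal, Complex.betaIntegral]
  congr 1
  refine intervalIntegral.integral_congr fun x hx => ?_
  rw [Set.uIcc_of_le zero_le_one] at hx
  simp only [Complex.ofReal_mul]
  rw [Complex.ofReal_cpow hx.1, Complex.ofReal_cpow (by linarith [hx.2])]
  push_cast
  rfl

lemma jacobiWeight_one_sub_two_mul (α β : ℝ) {u : ℝ} (hu : u ∈ Set.Icc (0 : ℝ) 1) :
    jacobiWeight α β (1 - 2 * u) = 2 ^ (α + β) * (u ^ α * (1 - u) ^ β) := by
  rw [jacobiWeight, show 1 - (1 - 2 * u) = 2 * u by ring,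
    show 1 + (1 - 2 * u) = 2 * (1 - u) by ring, Real.mul_rpow zero_le_two hu.1,
    Real.mul_rpow zero_le_two (sub_nonneg.2 hu.2), Real.rpow_add two_pos]
  ring

lemma jacobiMoment_one (hα : -1 < α) (hβ : -1 < β) :
    jacobiMoment hα hβ 1 = 2 ^ (α + β + 1) * ProbabilityTheory.beta (α + 1) (β + 1) := by
  have hsubst : (2 : ℝ) * ∫ u in (0 : ℝ)..1, jacobiWeight α β (1 - 2 * u) =
      ∫ x in (-1 : ℝ)..1, jacobiWeight α β x := by
    rw [← smul_eq_mul, intervalIntegral.smul_integral_comp_sub_mul]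
    norm_num
  have hbeta : ∫ u in (0 : ℝ)..1, jacobiWeight α β (1 - 2 * u) =
      2 ^ (α + β) * ProbabilityTheory.beta (α + 1) (β + 1) := by
    rw [beta_eq_integral (by linarith) (by linarith), ← intervalIntegral.integral_const_mul]
    refine intervalIntegral.integral_congr fun u hu => ?_
    rw [Set.uIcc_of_le zero_le_one] at hu
    simp only [jacobiWeight_one_sub_two_mul α β hu, add_sub_cancel_right]
  simp only [jacobiMoment_apply, eval_one, one_mul]
  rw [← hsubst, hbeta, Real.rpow_add_one two_ne_zero]
  ring

end Moment

/-! ### Orthonormal Jacobi polynomials -/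

section Orthonormal

variable {α β : ℝ}

lemma jacobiMoment_jacobi_mul_jacobi_of_ne (hα : -1 < α) (hβ : -1 < β) {n m : ℕ} (h : n ≠ m) :
    jacobiMoment hα hβ (jacobi α β n * jacobi α β m) = 0 := by
  have hsymm := jacobiMoment_diffOp_comm hα hβ 0 (jacobi α β n) (jacobi α β m)
  rw [diffOp_jacobi hα, diffOp_jacobi hα, mul_assoc, mul_left_comm (jacobi α β n),
    map_C_mul, map_C_mul, ← sub_eq_zero, ← sub_mul] at hsymm
  exact (mul_eq_zero.1 hsymm).resolve_left (sub_ne_zero.2 ((eig_injective hα hβ 0).ne h))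

lemma jacobiMoment_jacobi_succ_mul_self (hα : -1 < α) (hβ : -1 < β) (hα' : -1 < α + 1)
    (hβ' : -1 < β + 1) (n : ℕ) :
    4 * (n + 1) * jacobiMoment hα hβ (jacobi α β (n + 1) * jacobi α β (n + 1)) =
      (n + α + β + 2) * jacobiMoment hα' hβ'
        (jacobi (α + 1) (β + 1) n * jacobi (α + 1) (β + 1) n) := by
  have hne : (n : ℝ) + α + β + 2 ≠ 0 := by linarith [n.cast_nonneg (α := ℝ)]
  have hshift (p : ℝ[X]) : jacobiMoment hα hβ ((1 - X ^ 2) * p) = jacobiMoment hα' hβ' p := by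
    rw [jacobiMoment_add_one_left hα, jacobiMoment_add_one_right hα hβ]
    congr 1
    ring
  have hDirichlet := jacobiMoment_diffOp_mul hα hβ 0 (jacobi α β (n + 1)) (jacobi α β (n + 1))
  rw [zero_mul, add_zero, diffOp_jacobi hα, hshift, derivative_jacobi_succ hα, mul_assoc, mul_assoc,
    mul_left_comm (jacobi _ _ _), map_C_mul, map_C_mul, map_C_mul, eig] at hDirichlet
  push_cast at hDirichlet
  refine mul_left_cancel₀ hne ?_
  linear_combination 4 * hDirichlet

lemma jacobiMoment_jacobi_mul_self (hα : -1 < α) (hβ : -1 < β) (n : ℕ) (h : 0 < n + α + β + 1) :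
    (2 * n + α + β + 1) * n.factorial * Real.Gamma (n + α + β + 1) *
      jacobiMoment hα hβ (jacobi α β n * jacobi α β n) =
    2 ^ (α + β + 1) * Real.Gamma (n + α + 1) * Real.Gamma (n + β + 1) := by
  induction n generalizing α β with
  | zero =>
    simp only [Nat.cast_zero, zero_add] at h
    have hGamma : Real.Gamma (α + 1 + (β + 1)) = (α + β + 1) * Real.Gamma (α + β + 1) := by
      rw [← Real.Gamma_add_one h.ne']
      congr 1
      ring
    have hGamma_ne : Real.Gamma (α + β + 1) ≠ 0 := (Real.Gamma_pos_of_pos h).ne'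
    rw [jacobi_zero, mul_one, jacobiMoment_one, ProbabilityTheory.beta, hGamma]
    simp only [Nat.cast_zero, mul_zero, zero_add, Nat.factorial_zero, Nat.cast_one, mul_one]
    field_simp
  | succ n ih =>
    push_cast at h ⊢
    have hα' : -1 < α + 1 := by linarith
    have hβ' : -1 < β + 1 := by linarith
    have hih := ih hα' hβ' (by linarith)
    have hrec := jacobiMoment_jacobi_succ_mul_self hα hβ hα' hβ' n
    have hGamma := Real.Gamma_add_one (s := n + α + β + 2) (by linarith)
    have hpow : (2 : ℝ) ^ (α + 1 + (β + 1) + 1) = 4 * 2 ^ (α + β + 1) := by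
      rw [show α + 1 + (β + 1) + 1 = α + β + 1 + (2 : ℕ) by push_cast; ring,
        Real.rpow_add_natCast two_ne_zero]
      ring
    rw [hpow, show (n : ℝ) + (α + 1) + (β + 1) + 1 = n + α + β + 2 + 1 by ring, hGamma,
      show (n : ℝ) + (α + 1) + 1 = n + 1 + α + 1 by ring,
      show (n : ℝ) + (β + 1) + 1 = n + 1 + β + 1 by ring] at hih
    rw [Nat.factorial_succ, show (n : ℝ) + 1 + α + β + 1 = n + α + β + 2 by ring]
    push_cast
    linear_combination hih / 4 +
      (2 * n + α + β + 3) * n.factorial * Real.Gamma (n + α + β + 2) / 4 * hrec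

lemma jacobiMoment_jacobi_mul_self_pos (hα : -1 < α) (hβ : -1 < β) (n : ℕ) :
    0 < jacobiMoment hα hβ (jacobi α β n * jacobi α β n) :=
  jacobiMoment_mul_self_pos hα hβ (ne_zero_of_degree_gt (n := ⊥) (by simp [degree_jacobi hα hβ]))

lemma jacobiHat_eq_C_mul_jacobi (hα : -1 < α) (hβ : -1 < β) (n : ℕ) :
    jacobiHat α β n =
      C (√(jacobiMoment hα hβ (jacobi α β n * jacobi α β n)))⁻¹ * jacobi α β n := by
  rcases Nat.eq_zero_or_pos n with rfl | hn
  · rw [jacobiHat, if_pos rfl, jacobi_zero, mul_one, mul_one, jacobiMoment_one, one_div]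
  · have hn' : (1 : ℝ) ≤ n := by exact_mod_cast hn
    have hGamma : 0 < Real.Gamma (n + α + β + 1) := Real.Gamma_pos_of_pos (by linarith)
    have hlead : 0 < 2 * n + α + β + 1 := by linarith
    rw [jacobiHat, if_neg hn.ne', ← jacobiMoment_jacobi_mul_self hα hβ n (by linarith),
      ← Real.sqrt_inv, ← div_div, div_self (by positivity), one_div]

lemma isOrthonormal_jacobiHat (hα : -1 < α) (hβ : -1 < β) :
    IsOrthonormal (jacobiMoment hα hβ) (jacobiHat α β) := by
  intro n m
  rw [jacobiHat_eq_C_mul_jacobi hα hβ n, jacobiHat_eq_C_mul_jacobi hα hβ m, mul_mul_mul_comm,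
    ← C_mul, map_C_mul]
  split_ifs with h
  · subst h
    have hpos := jacobiMoment_jacobi_mul_self_pos hα hβ n
    rw [← mul_inv, Real.mul_self_sqrt hpos.le, inv_mul_cancel₀ hpos.ne']
  · rw [jacobiMoment_jacobi_mul_jacobi_of_ne hα hβ h, mul_zero]

lemma degree_jacobiHat (hα : -1 < α) (hβ : -1 < β) (n : ℕ) : (jacobiHat α β n).degree = n := by
  rw [jacobiHat_eq_C_mul_jacobi hα hβ, degree_C_mul, degree_jacobi hα hβ]
  exact inv_ne_zero (Real.sqrt_pos.2 (jacobiMoment_jacobi_mul_self_pos hα hβ n)).ne'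

/-- The orthonormal Jacobi polynomials, bundled with the fact that the `n`-th one has
degree `n`. -/
def jacobiHatSequence (hα : -1 < α) (hβ : -1 < β) : Sequence ℝ where
  elems' := jacobiHat α β
  degree_eq' := degree_jacobiHat hα hβ

lemma eval_jacobiHat_pos (hα : -1 < α) (hβ : -1 < β) (n : ℕ) {t : ℝ} (ht : 1 ≤ t) :
    0 < (jacobiHat α β n).eval t := by
  rw [jacobiHat_eq_C_mul_jacobi hα hβ, eval_mul, eval_C]
  exact mul_pos (inv_pos.2 (Real.sqrt_pos.2 (jacobiMoment_jacobi_mul_self_pos hα hβ n)))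
    (eval_jacobi_pos hα hβ n ht)

lemma diffOp_jacobiHat (hα : -1 < α) (hβ : -1 < β) (c : ℝ) (n : ℕ) :
    diffOp α β c (jacobiHat α β n) = C (eig α β c n) * jacobiHat α β n := by
  rw [jacobiHat_eq_C_mul_jacobi hα hβ, diffOp_C_mul, diffOp_jacobi hα, mul_left_comm]

end Orthonormal

/-! ### Modified kernel polynomials and the Sobolev form -/

section ModKernel

variable {α β c t : ℝ}

lemma degree_modKernel (hα : -1 < α) (hβ : -1 < β) (ht : 1 ≤ t) {n : ℕ} (hc : eig α β c n ≠ 0) :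
    (modKernel α β c t n).degree = n :=
  degree_sum_C_mul (jacobiHatSequence hα hβ)
    (mul_ne_zero (one_div_ne_zero hc) (eval_jacobiHat_pos hα hβ n ht).ne')

lemma diffOp_modKernel (hα : -1 < α) (hβ : -1 < β) (t : ℝ) {n : ℕ}
    (hc : ∀ k ≤ n, eig α β c k ≠ 0) :
    diffOp α β c (modKernel α β c t n) = kernel (jacobiHat α β) t n := by
  rw [modKernel, diffOp_sum, kernel]
  refine sum_congr rfl fun k hk => ?_
  have hk : eig α β c k ≠ 0 := hc k (Nat.lt_succ_iff.1 (mem_range.1 hk))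
  rw [diffOp_C_mul, diffOp_jacobiHat hα hβ, ← mul_assoc, ← C_mul]
  congr 2
  field_simp

lemma degree_kernel_jacobiHat (hα : -1 < α) (hβ : -1 < β) (ht : 1 ≤ t) (n : ℕ) :
    (kernel (jacobiHat α β) t n).degree = n :=
  degree_kernel (jacobiHatSequence hα hβ) (eval_jacobiHat_pos hα hβ n ht).ne'

lemma jacobiMoment_kernel_mul_kernel_of_ne (hα : -1 < α) (hβ : -1 < β) (ht : 1 ≤ t) {n m : ℕ}
    (h : n ≠ m) :
    jacobiMoment hα hβ
      (kernel (jacobiHat α β) t n * ((C t - X) * kernel (jacobiHat α β) t m)) = 0 :=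
  IsOrthonormal.apply_kernel_mul_kernel_of_ne (S := jacobiHatSequence hα hβ)
    (isOrthonormal_jacobiHat hα hβ) (fun k => (eval_jacobiHat_pos hα hβ k ht).ne') h

lemma jacobiMoment_kernel_mul_kernel_self_pos (hα : -1 < α) (hβ : -1 < β) (ht : 1 ≤ t) (n : ℕ) :
    0 < jacobiMoment hα hβ
      (kernel (jacobiHat α β) t n * ((C t - X) * kernel (jacobiHat α β) t n)) := by
  have hkernel : kernel (jacobiHat α β) t n ≠ 0 :=
    ne_zero_of_degree_gt (n := ⊥) (by simp [degree_kernel_jacobiHat hα hβ ht])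
  have hfactor : C t - X ≠ 0 := sub_ne_zero.2 (X_ne_C t).symm
  refine jacobiMoment_pos hα hβ (mul_ne_zero hkernel (mul_ne_zero hfactor hkernel)) fun x hx => ?_
  rw [eval_mul, eval_mul, mul_left_comm, eval_sub, eval_C, eval_X]
  exact mul_nonneg (by linarith [hx.2]) (mul_self_nonneg _)

lemma diffOp_kernel_one (hα : -1 < α) (hβ : -1 < β) (n : ℕ) :
    diffOp (α + 1) β 0 (kernel (jacobiHat α β) 1 n) =
      C (eig (α + 1) β 0 n) * kernel (jacobiHat α β) 1 n := by
  have hα' : -1 < α + 1 := by linarith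
  have horth (q : ℝ[X]) (hq : q.degree < n) :
      jacobiMoment hα' hβ (kernel (jacobiHat α β) 1 n * q) = 0 := by
    rw [jacobiMoment_add_one_left hα, mul_left_comm, ← C_1]
    exact IsOrthonormal.apply_kernel_mul_sub_mul (S := jacobiHatSequence hα hβ)
      (isOrthonormal_jacobiHat hα hβ) 1 hq
  exact eq_C_mul_of_symmetric_of_orthogonal
    (fun p hp => (jacobiMoment_mul_self_pos hα' hβ hp).ne') (jacobiMoment_diffOp_comm hα' hβ 0)
    (fun q hq => degree_diffOp_lt _ _ _ hq) horth
    (degree_diffOp_sub_eig_mul_lt _ _ _ (degree_kernel_jacobiHat hα hβ le_rfl n).le)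

lemma sobolevIntegrand_eq (α β c t : ℝ) (p q : ℝ[X]) :
    sobolevIntegrand α β c t p q = fun x =>
      (diffOp α β c p * ((C t - X) * diffOp α β c q)).eval x * jacobiWeight α β x := by
  ext x
  simp only [sobolevIntegrand, sobolevMatrix, coeffVec, jet, diffOp, jacobiWeight, dotProduct,
    Matrix.mulVec, Matrix.vecMulVec_apply, Fin.sum_univ_three, Matrix.cons_val, eval_add, eval_sub,
    eval_mul, eval_pow, eval_C, eval_X, eval_one]
  ring

lemma intervalIntegrable_sobolevIntegrand (hα : -1 < α) (hβ : -1 < β) (c t : ℝ) (p q : ℝ[X]) :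
    IntervalIntegrable (sobolevIntegrand α β c t p q) volume (-1) 1 := by
  rw [sobolevIntegrand_eq]
  exact intervalIntegrable_eval_mul_jacobiWeight hα hβ _

lemma integral_sobolevIntegrand (hα : -1 < α) (hβ : -1 < β) (c t : ℝ) (p q : ℝ[X]) :
    ∫ x in (-1 : ℝ)..1, sobolevIntegrand α β c t p q x =
      jacobiMoment hα hβ (diffOp α β c p * ((C t - X) * diffOp α β c q)) := by
  rw [sobolevIntegrand_eq, jacobiMoment_apply]

end ModKernel

end JacobiSobolev

end

open JacobiSobolev in
theorem theorem2_general (α β c t₀ : ℝ) (hα : -1 < α) (hβ : -1 < β) (hc : ∀ n, eig α β c n ≠ 0)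
    (ht₀ : 1 ≤ t₀) :
    (∀ n : ℕ, (modKernel α β c t₀ n).degree = n) ∧
    (∃ A : ℕ → ℝ, (∀ n, 0 < A n) ∧ ∀ n m : ℕ,
      IntervalIntegrable (sobolevIntegrand α β c t₀ (modKernel α β c t₀ n) (modKernel α β c t₀ m))
        MeasureTheory.volume (-1) 1 ∧
      ∫ x in (-1 : ℝ)..1,
          sobolevIntegrand α β c t₀ (modKernel α β c t₀ n) (modKernel α β c t₀ m) x =
        if n = m then A n else 0) ∧
    (∀ n : ℕ,
      diffOp (α + 1) β 0 (diffOp α β c (modKernel α β c 1 n)) =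
        Polynomial.C (eig (α + 1) β 0 n) * diffOp α β c (modKernel α β c 1 n)) := by
  have hdiffOp (t : ℝ) (n : ℕ) := diffOp_modKernel hα hβ t (n := n) fun k _ => hc k
  refine ⟨fun n => degree_modKernel hα hβ ht₀ (hc n),
    ⟨_, jacobiMoment_kernel_mul_kernel_self_pos hα hβ ht₀, fun n m =>
      ⟨intervalIntegrable_sobolevIntegrand hα hβ c t₀ _ _, ?_⟩⟩, fun n => ?_⟩
  · rw [integral_sobolevIntegrand hα hβ, hdiffOp, hdiffOp]
    split_ifs with h
    · rw [h]
    · exact jacobiMoment_kernel_mul_kernel_of_ne hα hβ ht₀ h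
  · rw [hdiffOp]
    exact diffOp_kernel_one hα hβ n

theorem theorem2 (α β c t₀ : ℝ) (hα : -1 < α) (hβ : -1 < β) (hc : 0 < c) (ht₀ : 1 ≤ t₀) :
    (∀ n : ℕ, (JacobiSobolev.modKernel α β c t₀ n).degree = n) ∧
    (∃ A : ℕ → ℝ, (∀ n, 0 < A n) ∧ ∀ n m : ℕ,
      IntervalIntegrable
        (JacobiSobolev.sobolevIntegrand α β c t₀
          (JacobiSobolev.modKernel α β c t₀ n) (JacobiSobolev.modKernel α β c t₀ m))
        MeasureTheory.volume (-1) 1 ∧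
      ∫ x in (-1 : ℝ)..1, JacobiSobolev.sobolevIntegrand α β c t₀
          (JacobiSobolev.modKernel α β c t₀ n) (JacobiSobolev.modKernel α β c t₀ m) x
        = if n = m then A n else 0) ∧
    (∀ n : ℕ,
      JacobiSobolev.diffOp (α + 1) β 0
          (JacobiSobolev.diffOp α β c (JacobiSobolev.modKernel α β c 1 n)) =
        Polynomial.C (JacobiSobolev.eig (α + 1) β 0 n) *
          JacobiSobolev.diffOp α β c (JacobiSobolev.modKernel α β c 1 n)) :=
  theorem2_general α β c t₀ hα hβ (fun n => (JacobiSobolev.eig_pos hα hβ hc n).ne') ht₀
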